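/- Let $\mathbb N=\{1,2,\dots\}$, let $V=(V_n)_{n\ge1}$ be a bounded real sequence, and let $H$ be the half-line discrete Schrödinger operator on $\ell^2(\mathbb N)$, $(H\psi)_n=\psi_{n+1}+\psi_{n-1}+V_n\psi_n$ with the convention $\psi_0=0$. For $q\ge 0$ and $T>0$ put $$P(q,T)=\sum_{n>q}\frac2T\int_0^\infty\left|\langle\delta_n,e^{-itH}\delta_1\rangle\right|^2e^{-2t/T}\,dt,$$ and define $$\alpha_l^+=\sup\Big\{\alpha>0 : \limsup_{T\to\infty}\frac{\log P(T^\alpha,T)}{\log T}=0\Big\},\qquad \alpha_l^-=\sup\Big\{\alpha>0 : \liminf_{T\to\infty}\frac{\log P(T^\alpha,T)}{\log T}=0\Big\},$$ where $\limsup$ and $\liminf$ are taken in $[-\infty,\infty]$ and the suprema in $[0,\infty]$ (so $\sup\emptyset=0$). For an integer $q>1$ and $k\in[0,\pi]$ let $H^q(k)$ be the restriction of $H$ to $\{1,\dots,q\}$ with boundary condition $\psi(q+1)=e^{ik}\psi(1)$, i.e. the Hermitian $q\times q$ matrix with diagonal entries $V_1,\dots,V_q$, entries $1$ next to the diagonal,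 and additional corner contributions $e^{-ik}$ in position $(1,q)$ and $e^{ik}$ in position $(q,1)$ (added to the entries $1$ if $q=2$). Let $E_{q,1}(k)\le\dots\le E_{q,q}(k)$ be its eigenvalues, counted with multiplicity, and let $b_{q,j}=|E_{q,j}(\pi)-E_{q,j}(0)|$ for $1\le j\le q$. Suppose that there exist $\beta>3$ and a sequence of integers $q_\ell>1$, $\ell\ge1$, with $q_\ell\to\infty$, such that $$\sup_{1\le j\le q_\ell}b_{q_\ell,j}<q_\ell^{-\beta}\qquad\text{for all }\ell.$$ Then $\alpha_l^-\le 3/\beta$. If, moreover, $(q_\ell)$ is exponentially growing, that is, $\sup_\ell q_{\ell+1}/q_\ell<\infty$ and $\inf_\ell q_{\ell+1}/q_\ell>1$, then also $\alpha_l^+\le 3/\beta$. -/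

import Mathlib

open scoped lp ENNReal

namespace HalfLine

/-- `(Lψ)_n = ψ_{n+1}` on `ℓ²(ℕ)`, where `ℕ = {1, 2, …}`. -/
noncomputable def shiftLeft : ℓ²(ℕ+, ℂ) →L[ℂ] ℓ²(ℕ+, ℂ) :=
  LinearMap.mkContinuous
    { toFun := fun ψ => ⟨fun n => ψ (n + 1), memℓp_gen
        (((lp.memℓp ψ).summable (by norm_num)).comp_injective (add_left_injective (1 : ℕ+)))⟩
      map_add' := fun _ _ => rfl
      map_smul' := fun _ _ => rfl } 1 (by
    intro ψ
    rw [one_mul]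
    refine lp.norm_le_of_tsum_le (by norm_num) (norm_nonneg _) ?_
    rw [lp.norm_rpow_eq_tsum (by norm_num)]
    have hs : Summable fun n : ℕ+ => ‖ψ n‖ ^ (2 : ℝ≥0∞).toReal :=
      (lp.memℓp ψ).summable (by norm_num)
    exact tsum_comp_le_tsum_of_inj hs (fun n => by positivity) (add_left_injective (1 : ℕ+)))

/-- The function `n ↦ ψ_{n-1}`, with the convention `ψ_0 = 0`. -/
def prev (ψ : ℕ+ → ℂ) (n : ℕ+) : ℂ := if n = 1 then 0 else ψ (n - 1)

lemma prev_hasSum (ψ : ℓ²(ℕ+, ℂ)) :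
    HasSum (fun n => ‖prev ψ n‖ ^ (2 : ℝ≥0∞).toReal) (‖ψ‖ ^ (2 : ℝ≥0∞).toReal) := by
  rw [← (add_left_injective (1 : ℕ+)).hasSum_iff]
  · convert lp.hasSum_norm (by norm_num) ψ using 2 with n
    have h : n + 1 ≠ 1 := PNat.add_one n ▸ (PNat.lt_add_left 1 n).ne'
    simp [prev, h]
  · intro n hn
    have : n = 1 := by
      by_contra h
      exact hn ⟨n - 1, PNat.sub_add_of_lt (lt_of_le_of_ne one_le (Ne.symm h))⟩
    simp [prev, this]

/-- `(Rψ)_n = ψ_{n-1}` for `n > 1` and `(Rψ)_1 = 0`. -/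
noncomputable def shiftRight : ℓ²(ℕ+, ℂ) →L[ℂ] ℓ²(ℕ+, ℂ) :=
  LinearMap.mkContinuous
    { toFun := fun ψ => ⟨prev ψ, memℓp_gen (prev_hasSum ψ).summable⟩
      map_add' := fun ψ φ => by
        ext n
        change prev (ψ + φ) n = prev ψ n + prev φ n
        by_cases h : n = 1 <;> simp [prev, h]
      map_smul' := fun c ψ => by
        ext n
        change prev (c • ψ) n = c * prev ψ n
        by_cases h : n = 1 <;> simp [prev, h] } 1 (by
    intro ψ
    rw [one_mul]
    exact lp.norm_le_of_tsum_le (by norm_num) (norm_nonneg _) (prev_hasSum ψ).tsum_eq.le)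

lemma potential_bound (V : ℓ^∞(ℕ+, ℝ)) (ψ : ℓ²(ℕ+, ℂ)) (n : ℕ+) :
    ‖(V n : ℂ) * ψ n‖ ≤ ‖(((‖V‖ : ℝ) : ℂ) • ψ) n‖ := by
  have h := lp.norm_apply_le_norm (by simp) V n
  simp only [lp.coeFn_smul, Pi.smul_apply, smul_eq_mul, norm_mul, Complex.norm_real, norm_norm]
  gcongr

/-- Multiplication by the bounded real potential `V`. -/
noncomputable def mulPotential (V : ℓ^∞(ℕ+, ℝ)) : ℓ²(ℕ+, ℂ) →L[ℂ] ℓ²(ℕ+, ℂ) :=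
  LinearMap.mkContinuous
    { toFun := fun ψ => ⟨fun n => (V n : ℂ) * ψ n,
        (lp.memℓp (((‖V‖ : ℝ) : ℂ) • ψ)).mono' (potential_bound V ψ)⟩
      map_add' := fun ψ φ => by ext n; exact mul_add _ _ _
      map_smul' := fun c ψ => by ext n; simp; ring } ‖V‖ (by
    intro ψ
    refine (lp.norm_mono two_ne_zero (y := ((‖V‖ : ℝ) : ℂ) • ψ) (potential_bound V ψ)).trans ?_
    rw [lp.norm_const_smul (by simp)]
    simp)

/-- The half-line discrete Schrödinger operator with bounded potential `V`
(see `schrodinger_apply` for its action). -/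
noncomputable def schrodinger (V : ℓ^∞(ℕ+, ℝ)) : ℓ²(ℕ+, ℂ) →L[ℂ] ℓ²(ℕ+, ℂ) :=
  shiftLeft + shiftRight + mulPotential V

lemma schrodinger_apply (V : ℓ^∞(ℕ+, ℝ)) (ψ : ℓ²(ℕ+, ℂ)) (n : ℕ+) :
    schrodinger V ψ n = ψ (n + 1) + (if n = 1 then 0 else ψ (n - 1)) + (V n : ℂ) * ψ n := rfl

/-- The unit vector `δ_n`. -/
noncomputable def delta (n : ℕ+) : ℓ²(ℕ+, ℂ) := lp.single 2 n (1 : ℂ)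

/-- The unitary time evolution `e^{-itH}`. -/
noncomputable def evolution (V : ℓ^∞(ℕ+, ℝ)) (t : ℝ) : ℓ²(ℕ+, ℂ) →L[ℂ] ℓ²(ℕ+, ℂ) :=
  NormedSpace.exp ((-(Complex.I * (t : ℂ))) • schrodinger V)

/-- `P(q, T) = ∑_{n > q} (2/T) ∫_0^∞ |⟨δ_n, e^{-itH} δ_1⟩|² e^{-2t/T} dt`. -/
noncomputable def tailProb (V : ℓ^∞(ℕ+, ℝ)) (q T : ℝ) : ℝ :=
  ∑' n : {n : ℕ+ // q < (n : ℝ)},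
    2 / T * ∫ t in Set.Ioi (0 : ℝ),
      ‖inner ℂ (delta n) (evolution V t (delta 1))‖ ^ 2 * Real.exp (-2 * t / T)

/-- `log P(T^α, T) / log T`, as an extended real, so that `limsup` and `liminf` may be `-∞`. -/
noncomputable def tailRate (V : ℓ^∞(ℕ+, ℝ)) (α T : ℝ) : EReal :=
  ((Real.log (tailProb V (T ^ α) T) / Real.log T : ℝ) : EReal)

/-- The exponent `α_l^+`; the supremum is taken in `[0, ∞]`. -/
noncomputable def alphaLowerPlus (V : ℓ^∞(ℕ+, ℝ)) : ℝ≥0∞ :=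
  ⨆ α ∈ {α : ℝ | 0 < α ∧ Filter.limsup (tailRate V α) Filter.atTop = 0}, ENNReal.ofReal α

/-- The exponent `α_l^-`; the supremum is taken in `[0, ∞]`. -/
noncomputable def alphaLowerMinus (V : ℓ^∞(ℕ+, ℝ)) : ℝ≥0∞ :=
  ⨆ α ∈ {α : ℝ | 0 < α ∧ Filter.liminf (tailRate V α) Filter.atTop = 0}, ENNReal.ofReal α

/-- The restriction `H^q(k)` of `H` to `{1, …, q}` with boundary condition
`ψ(q+1) = e^{ik} ψ(1)`. The site `j ∈ {1, …, q}` is the index `j - 1 : Fin q`. The contributions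
are added, so that for `q = 2` the off-diagonal entries are `1 + e^{∓ik}`. -/
noncomputable def truncation (V : ℓ^∞(ℕ+, ℝ)) (q : ℕ) (k : ℝ) : Matrix (Fin q) (Fin q) ℂ :=
  fun i j =>
    (if i = j then (V (Nat.succPNat i) : ℂ) else 0)
    + (if (i : ℕ) + 1 = j then 1 else 0)
    + (if (j : ℕ) + 1 = i then 1 else 0)
    + (if (i : ℕ) = 0 ∧ (j : ℕ) + 1 = q then Complex.exp (-(Complex.I * (k : ℂ))) else 0)
    + (if (j : ℕ) = 0 ∧ (i : ℕ) + 1 = q then Complex.exp (Complex.I * (k : ℂ)) else 0)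

lemma truncation_isHermitian (V : ℓ^∞(ℕ+, ℝ)) (q : ℕ) (k : ℝ) :
    (truncation V q k).IsHermitian := by
  ext i j
  have h1 : (starRingEnd ℂ) (Complex.exp (-(Complex.I * (k : ℂ))))
      = Complex.exp (Complex.I * (k : ℂ)) := by
    rw [← Complex.exp_conj]; simp
  have h2 : (starRingEnd ℂ) (Complex.exp (Complex.I * (k : ℂ)))
      = Complex.exp (-(Complex.I * (k : ℂ))) := by
    rw [← Complex.exp_conj]; simp
  rw [Matrix.conjTranspose_apply]
  simp only [truncation, star_add, apply_ite (star : ℂ → ℂ), RCLike.star_def, h1, h2, map_zero,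
    map_one, Complex.conj_ofReal]
  have e : (if j = i then (V (Nat.succPNat j) : ℂ) else 0)
      = if i = j then (V (Nat.succPNat i) : ℂ) else 0 := by
    by_cases h : i = j
    · simp [h]
    · simp [h, Ne.symm h]
  rw [e]
  ring

/-- `E_{q,j}(k)`: the eigenvalues of `H^q(k)`, listed with multiplicity in increasing order
(`Matrix.IsHermitian.eigenvalues₀` is in decreasing order). -/
noncomputable def eigenvalue (V : ℓ^∞(ℕ+, ℝ)) (q : ℕ) (j : Fin q) (k : ℝ) : ℝ :=
  (truncation_isHermitian V q k).eigenvalues₀ (Fin.cast (Fintype.card_fin q).symm j.rev)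

/-- The band width `b_{q,j} = |E_{q,j}(π) - E_{q,j}(0)|`. -/
noncomputable def bandWidth (V : ℓ^∞(ℕ+, ℝ)) (q : ℕ) (j : Fin q) : ℝ :=
  |eigenvalue V q j Real.pi - eigenvalue V q j 0|

/-- A sequence is exponentially growing if `sup a_{n+1}/a_n < ∞` and `inf a_{n+1}/a_n > 1`. -/
def ExponentiallyGrowing (a : ℕ → ℝ) : Prop :=
  BddAbove (Set.range fun n => a (n + 1) / a n) ∧ 1 < ⨅ n, a (n + 1) / a n

end HalfLine

/-! Write `ε = 1/T`, `z = E + iε`, `G = (z - H)⁻¹` and `F = det (z - H^q(0))`. Since `G` is the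
Laplace transform of the evolution, Plancherel in time turns `P(x, T)` into an energy integral of
`∑_{n > x} |G(n, 1)|²`. Two facts make this small when `x ≥ q` and all bands of `H^q` are shorter
than `b`.

Thin bands make `F` large (`norm_det_truncation_inv_le`). In `det (z - H^q(k))` the phase enters
only through `-2 cos k` times a number of modulus one, so the determinants at `k = π` and `k = 0`
differ by exactly 4 in modulus. Their ratio is a product over eigenvalues that move by at most `b`,
hence is close to 1. Both can hold only if `|F|` is large.

A large `F` makes the resolvent small beyond `q` (`exists_tail_vector`): there `F · G(n, 1)` agrees
with an `ℓ²` vector of norm at most `5/ε²`.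

Integrating the resulting Lorentzians in `E` gives `P ≤ (25/4) T⁴ q² b²` (`tailProb_bounds`). For `b
= q^{-β}` and `q` comparable to `T^{α'}` this is of order `T^{4 - 2α'(β - 1)}`, a negative power
when `3/β < α' ≤ 1`. The times `T = q_ℓ^{1/α'}` settle the liminf; if the ratios `q_{ℓ+1}/q_ℓ` are
bounded, every large `T` is comparable to such a time, which settles the limsup. -/

namespace HalfLine
open MeasureTheory FourierTransform SchwartzMap
open scoped ContDiff

/-! ### Analytic tools: Plancherel, the Lorentzian integral, the resolvent bound. -/

/-- The Fourier integral of an integrable square-integrable function represents its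
`L²`-Fourier transform. -/
lemma fourier_toLp_ae_eq {f : ℝ → ℂ} (h1 : Integrable f) (h2 : MemLp f 2) :
    (𝓕 (h2.toLp f) : Lp ℂ 2 (volume : Measure ℝ)) =ᵐ[volume] 𝓕 f := by
  have hcont : Continuous (𝓕 f) :=
    VectorFourier.fourierIntegral_continuous Real.continuous_fourierChar
      (by fun_prop) h1
  -- It suffices to test against smooth compactly supported `g`; on either side the Fourier
  -- transform can be moved onto `g`.
  refine ae_eq_of_integral_contDiff_smul_eq
    ((Lp.memLp _).locallyIntegrable (by norm_num)) hcont.locallyIntegrable fun g hg hgc => ?_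
  have hg₁ : HasCompactSupport (Complex.ofRealCLM ∘ g) := hgc.comp_left rfl
  have hg₂ : ContDiff ℝ ∞ (Complex.ofRealCLM ∘ g) := by fun_prop
  have key := congrArg (fun u => u (hg₁.toSchwartzMap hg₂))
    (Lp.fourier_toTemperedDistribution_eq (h2.toLp f))
  simp only [TemperedDistribution.fourier_apply, Lp.toTemperedDistribution_apply] at key
  have e1 : ∀ x, (hg₁.toSchwartzMap hg₂) x = (g x : ℂ) := fun x => rfl
  simp only [e1] at key
  have e2 : ∀ (x : ℝ) (w : ℂ), g x • w = (g x : ℂ) • w := fun x w => by simp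
  simp only [e2]
  rw [← key]
  have e3 : ∫ x, (𝓕 (hg₁.toSchwartzMap hg₂)) x • (h2.toLp f) x
      = ∫ x, (𝓕 (hg₁.toSchwartzMap hg₂)) x • f x := by
    refine integral_congr_ae ?_
    filter_upwards [h2.coeFn_toLp] with x hx
    rw [hx]
  rw [e3]
  have := VectorFourier.integral_fourierIntegral_smul_eq_flip (L := innerₗ ℝ)
    (μ := (volume : Measure ℝ)) (ν := (volume : Measure ℝ))
    Real.continuous_fourierChar (by fun_prop) (hg₁.toSchwartzMap hg₂).integrable h1
  rw [flip_innerₗ] at this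
  exact this

/-- Plancherel's theorem for functions in `L¹ ∩ L²`. -/
lemma plancherel {f : ℝ → ℂ} (h1 : Integrable f) (h2 : MemLp f 2) :
    MemLp (𝓕 f) 2 ∧ ∫ ξ, ‖𝓕 f ξ‖ ^ 2 = ∫ x, ‖f x‖ ^ 2 := by
  have hae := fourier_toLp_ae_eq h1 h2
  have hm : MemLp (𝓕 f) 2 := (memLp_congr_ae hae).1 (Lp.memLp _)
  refine ⟨hm, ?_⟩
  have h := Lp.norm_fourier_eq (h2.toLp f)
  have n : ∀ u : Lp ℂ 2 (volume : Measure ℝ), ‖u‖ ^ 2 = ∫ x, ‖u x‖ ^ 2 := fun u => by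
    have := L2.inner_def (𝕜 := ℂ) u u
    rw [inner_self_eq_norm_sq_to_K] at this
    simp only [inner_self_eq_norm_sq_to_K] at this
    have h3 := congrArg Complex.re this
    have : ∫ x, ((‖u x‖ : ℂ)) ^ 2 = ((∫ x, ‖u x‖ ^ 2 : ℝ) : ℂ) := by
      rw [← integral_complex_ofReal]; simp
    simp only [Complex.coe_algebraMap] at h3
    rw [this] at h3
    exact_mod_cast h3
  have h' : ‖(𝓕 (h2.toLp f) : Lp ℂ 2 (volume : Measure ℝ))‖ ^ 2 = ‖h2.toLp f‖ ^ 2 := by rw [h]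
  rw [n, n] at h'
  rw [integral_congr_ae (g := fun ξ => ‖𝓕 f ξ‖ ^ 2)
      (by filter_upwards [hae] with x hx; rw [hx])] at h'
  rw [h']
  refine integral_congr_ae ?_
  filter_upwards [h2.coeFn_toLp] with x hx
  rw [hx]

lemma integral_inv_sq_add_sq (a : ℝ) {ε : ℝ} (hε : 0 < ε) :
    Integrable (fun E : ℝ => ((E - a) ^ 2 + ε ^ 2)⁻¹) ∧
      ∫ E : ℝ, ((E - a) ^ 2 + ε ^ 2)⁻¹ = Real.pi / ε := by
  have e : (fun E : ℝ => ((E - a) ^ 2 + ε ^ 2)⁻¹)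
      = fun E => (fun y : ℝ => (ε ^ 2)⁻¹ * (fun x : ℝ => (1 + x ^ 2)⁻¹) (ε⁻¹ * y)) (E - a) := by
    funext E
    have : (E - a) ^ 2 + ε ^ 2 = ε ^ 2 * (1 + (ε⁻¹ * (E - a)) ^ 2) := by field_simp; ring
    simp only [this, mul_inv]
  constructor
  · rw [e]
    exact ((integrable_inv_one_add_sq.comp_mul_left' (inv_ne_zero hε.ne')).const_mul _).comp_sub_right a
  · rw [e, integral_sub_right_eq_self (fun y : ℝ => (ε ^ 2)⁻¹ * (fun x : ℝ => (1 + x ^ 2)⁻¹) (ε⁻¹ * y)),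
      integral_const_mul, Measure.integral_comp_mul_left (fun x : ℝ => (1 + x ^ 2)⁻¹),
      integral_univ_inv_one_add_sq]
    simp [abs_of_pos hε]
    field_simp

/-- A symmetric operator satisfies `|Im z| ‖x‖ ≤ ‖(z - T) x‖`. -/
lemma symmetric_im_mul_norm_le {E : Type*} [NormedAddCommGroup E] [InnerProductSpace ℂ E]
    {T : E →ₗ[ℂ] E} (hT : T.IsSymmetric) (z : ℂ) (x : E) :
    z.im * ‖x‖ ≤ ‖z • x - T x‖ := by
  rcases eq_or_ne x 0 with rfl | hx
  · simp
  -- The form `⟨x, T x⟩` is real, so only `z` contributes to the imaginary part.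
  have h1 : (inner ℂ x (z • x - T x)).im = z.im * ‖x‖ ^ 2 := by
    have : (inner ℂ x (T x)).im = 0 := hT.im_inner_self_apply x
    rw [inner_sub_right, inner_smul_right, inner_self_eq_norm_sq_to_K, Complex.sub_im, this]
    simp [← Complex.ofReal_pow]
  have h2 : z.im * ‖x‖ ^ 2 ≤ ‖x‖ * ‖z • x - T x‖ :=
    h1 ▸ ((le_abs_self _).trans (Complex.abs_im_le_norm _)).trans (norm_inner_le_norm _ _)
  have := norm_pos_iff.2 hx
  nlinarith

end HalfLine

/-! ### Finite matrices and the Floquet determinant. -/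

namespace HalfLine

/-- The restriction of `H` to `{1, …, q}` with Dirichlet boundary conditions. -/
noncomputable def dirichlet (V : ℓ^∞(ℕ+, ℝ)) (q : ℕ) : Matrix (Fin q) (Fin q) ℂ :=
  fun i j =>
    (if i = j then (V (Nat.succPNat i) : ℂ) else 0)
    + (if (i : ℕ) + 1 = j then 1 else 0)
    + (if (j : ℕ) + 1 = i then 1 else 0)

lemma dirichlet_transpose (V : ℓ^∞(ℕ+, ℝ)) (q : ℕ) : (dirichlet V q).transpose = dirichlet V q := by
  ext i j
  simp only [Matrix.transpose_apply, dirichlet]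
  by_cases h : i = j
  · subst h; simp
  · simp only [h, Ne.symm h, if_false]; ring

lemma dirichlet_isHermitian (V : ℓ^∞(ℕ+, ℝ)) (q : ℕ) : (dirichlet V q).IsHermitian := by
  have h : (dirichlet V q).map star = dirichlet V q := by
    ext i j
    simp [dirichlet, apply_ite (starRingEnd ℂ)]
  rw [Matrix.IsHermitian, Matrix.conjTranspose, dirichlet_transpose, h]

/-- The matrix `z - H_q`, where `H_q` is the Dirichlet restriction of `H` to `{1, …, q}`. -/
noncomputable def shiftedDirichlet (V : ℓ^∞(ℕ+, ℝ)) (q : ℕ) (z : ℂ) : Matrix (Fin q) (Fin q) ℂ :=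
  z • 1 - dirichlet V q

lemma shiftedDirichlet_transpose (V : ℓ^∞(ℕ+, ℝ)) (q : ℕ) (z : ℂ) :
    (shiftedDirichlet V q z).transpose = shiftedDirichlet V q z := by
  simp [shiftedDirichlet, dirichlet_transpose]

lemma isHermitian_im_mul_norm_le {n : Type*} [Fintype n] [DecidableEq n] {A : Matrix n n ℂ}
    (hA : A.IsHermitian) (z : ℂ) (x : n → ℂ) :
    z.im * ‖WithLp.toLp 2 x‖ ≤ ‖WithLp.toLp 2 ((z • (1 : Matrix n n ℂ) - A).mulVec x)‖ := by
  have h := symmetric_im_mul_norm_le (Matrix.isSymmetric_toEuclideanLin_iff.2 hA) z (WithLp.toLp 2 x)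
  have e : WithLp.toLp 2 ((z • (1 : Matrix n n ℂ) - A).mulVec x)
      = z • WithLp.toLp 2 x - A.toEuclideanLin (WithLp.toLp 2 x) := by
    rw [Matrix.sub_mulVec, Matrix.smul_mulVec, Matrix.one_mulVec]
    rfl
  rw [e]
  exact h

lemma isUnit_det_smul_one_sub {n : Type*} [Fintype n] [DecidableEq n] {A : Matrix n n ℂ}
    (hA : A.IsHermitian) {z : ℂ} (hz : 0 < z.im) : IsUnit (z • (1 : Matrix n n ℂ) - A).det := by
  rw [isUnit_iff_ne_zero]
  intro h
  obtain ⟨v, hv, hv0⟩ := Matrix.exists_mulVec_eq_zero_iff.2 h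
  have := isHermitian_im_mul_norm_le hA z v
  rw [hv0] at this
  simp only [WithLp.toLp_zero, norm_zero] at this
  have h0 : ‖WithLp.toLp 2 v‖ ≤ 0 := by
    by_contra! hc
    nlinarith
  exact hv (by simpa using h0)

lemma norm_inv_apply_le {n : Type*} [Fintype n] [DecidableEq n] {A : Matrix n n ℂ}
    (hA : A.IsHermitian) {z : ℂ} (hz : 0 < z.im) (i j : n) :
    ‖(z • (1 : Matrix n n ℂ) - A)⁻¹ i j‖ ≤ 1 / z.im := by
  set M := z • (1 : Matrix n n ℂ) - A with hM
  have h := isHermitian_im_mul_norm_le hA z (M⁻¹.mulVec (Pi.single j 1))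
  rw [← hM, Matrix.mulVec_mulVec, Matrix.mul_nonsing_inv _ (isUnit_det_smul_one_sub hA hz),
    Matrix.one_mulVec] at h
  have h1 : ‖WithLp.toLp 2 (Pi.single j (1 : ℂ) : n → ℂ)‖ = 1 := by
    simp
  rw [h1] at h
  have h2 := PiLp.norm_apply_le (WithLp.toLp 2 (M⁻¹.mulVec (Pi.single j (1 : ℂ)))) i
  simp only [Matrix.mulVec_single_one, Matrix.col_apply] at h2 h
  rw [le_div_iff₀ hz]
  nlinarith

variable (V : ℓ^∞(ℕ+, ℝ))

/-- Deleting the last row and the first column of a tridiagonal matrix leaves a lower triangular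
one, whose diagonal is the old superdiagonal, here constantly `-1`. -/
lemma norm_adjugate_corner (m : ℕ) (z : ℂ) :
    ‖(shiftedDirichlet V (m + 1) z).adjugate 0 (Fin.last m)‖ = 1 := by
  have hsub : ∀ i j : Fin m, (shiftedDirichlet V (m + 1) z).submatrix Fin.castSucc Fin.succ i j
      = if i = j then -1 else if i < j then 0 else
        (shiftedDirichlet V (m + 1) z) i.castSucc j.succ := by
    intro i j
    have hij : ∀ a b : Fin m, (a.castSucc = b.succ) ↔ (a : ℕ) = b + 1 := fun a b => by
      simp [Fin.ext_iff]
    split_ifs with h h'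
    · subst h
      have e3 : ¬ ((i : ℕ) + 1 + 1 = i) := by omega
      simp [shiftedDirichlet, dirichlet, hij, e3]
    · have hlt : (i : ℕ) < j := h'
      have e1 : ¬ (i : ℕ) = j + 1 := by omega
      have e2 : ¬ (i : ℕ) = j := by omega
      have e3 : ¬ ((j : ℕ) + 1 + 1 = i) := by omega
      simp [shiftedDirichlet, dirichlet, hij, e1, e2, e3]
    · rfl
  rw [Matrix.adjugate_fin_succ_eq_det_submatrix, Fin.succAbove_last, Fin.succAbove_zero,
    Matrix.det_of_isLowerTriangular]
  · simp [hsub, -Matrix.submatrix_apply]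
  · intro i j hij
    have : i < j := by simpa using hij
    rw [hsub, if_neg this.ne, if_pos this]

/-- The determinant of a corner perturbation. -/
lemma det_sub_corners {n : Type*} [Fintype n] [DecidableEq n] (M : Matrix n n ℂ)
    (hM : IsUnit M.det) (a b : n) (c d : ℂ) :
    (M - Matrix.of fun i j =>
      (if i = a ∧ j = b then c else 0) + (if j = a ∧ i = b then d else 0)).det
      = M.det * ((1 - c * M⁻¹ b a) * (1 - d * M⁻¹ a b) - c * d * (M⁻¹ a a * M⁻¹ b b)) := by
  -- The corner term has rank at most two. Factoring the perturbed matrix as `M (1 + A B)` and using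
  -- `det (1 + A B) = det (1 + B A)` leaves a 2×2 determinant.
  set A : Matrix n (Fin 2) ℂ := Matrix.of fun i s => ![-c * M⁻¹ i a, -d * M⁻¹ i b] s with hA
  set B : Matrix (Fin 2) n ℂ := Matrix.of fun s j => ![if j = b then 1 else 0, if j = a then 1 else 0] s
    with hB
  have h1 : (M - Matrix.of fun i j =>
      (if i = a ∧ j = b then c else 0) + (if j = a ∧ i = b then d else 0))
      = M * (1 + A * B) := by
    rw [mul_add, mul_one, sub_eq_add_neg]
    congr 1
    have : A = M⁻¹ * Matrix.of fun i (s : Fin 2) =>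
        ![if i = a then -c else 0, if i = b then -d else 0] s := by
      ext i s
      fin_cases s <;> simp [hA, Matrix.mul_apply, mul_comm]
    rw [this, ← Matrix.mul_assoc, ← Matrix.mul_assoc, Matrix.mul_nonsing_inv _ hM, Matrix.one_mul]
    ext i j
    simp only [Matrix.neg_apply, Matrix.mul_apply, Matrix.of_apply, Fin.sum_univ_two, hB]
    simp only [Matrix.cons_val_zero, Matrix.cons_val_one, ite_and]
    split_ifs <;> ring
  rw [h1, Matrix.det_mul, Matrix.det_one_add_mul_comm, Matrix.det_fin_two]
  congr 1
  simp [Matrix.mul_apply, hA, hB]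
  ring

/-- The two corner phases enter only through their product, which is 1, and their sum `2 cos k`. All
dependence on `k` therefore sits in one term, whose size `norm_adjugate_corner` gives. -/
lemma det_truncation (m : ℕ) (k : ℝ) {z : ℂ} (hz : 0 < z.im) :
    (z • 1 - truncation V (m + 1) k).det = (shiftedDirichlet V (m + 1) z).det *
      (1 + (shiftedDirichlet V (m + 1) z)⁻¹ 0 (Fin.last m) ^ 2 -
        (shiftedDirichlet V (m + 1) z)⁻¹ 0 0 *
          (shiftedDirichlet V (m + 1) z)⁻¹ (Fin.last m) (Fin.last m))
      - 2 * Real.cos k * (shiftedDirichlet V (m + 1) z).adjugate 0 (Fin.last m) := by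
  set M := shiftedDirichlet V (m + 1) z with hM
  have hu : IsUnit M.det := isUnit_det_smul_one_sub (dirichlet_isHermitian V _) hz
  have h1 : z • 1 - truncation V (m + 1) k = M - Matrix.of fun i j =>
      (if i = 0 ∧ j = Fin.last m then Complex.exp (-(Complex.I * (k : ℂ))) else 0) +
        (if j = 0 ∧ i = Fin.last m then Complex.exp (Complex.I * (k : ℂ)) else 0) := by
    ext i j
    have e : ∀ a : Fin (m + 1), ((a : ℕ) = 0 ↔ a = 0) := fun a => by rw [Fin.ext_iff]; rfl
    have e' : ∀ a : Fin (m + 1), ((a : ℕ) + 1 = m + 1 ↔ a = Fin.last m) := fun a => by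
      simp [Fin.ext_iff]
    simp only [hM, shiftedDirichlet, dirichlet, truncation, Matrix.sub_apply, Matrix.of_apply, e, e']
    ring
  have hsymm : M⁻¹ (Fin.last m) 0 = M⁻¹ 0 (Fin.last m) := by
    have := congrArg (fun X => X 0 (Fin.last m)) (Matrix.transpose_nonsing_inv M)
    rw [hM, shiftedDirichlet_transpose] at this
    exact this
  have hadj : M.adjugate 0 (Fin.last m) = M.det * M⁻¹ 0 (Fin.last m) := by
    rw [Matrix.inv_def, Matrix.smul_apply, smul_eq_mul, ← mul_assoc, Ring.mul_inverse_cancel _ hu,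
      one_mul]
  have hexp : Complex.exp (-(Complex.I * (k : ℂ))) * Complex.exp (Complex.I * (k : ℂ)) = 1 := by
    rw [← Complex.exp_add]; simp
  have hcos : Complex.exp (-(Complex.I * (k : ℂ))) + Complex.exp (Complex.I * (k : ℂ))
      = 2 * Real.cos k := by
    rw [Complex.ofReal_cos, Complex.cos, mul_comm Complex.I, neg_mul]; ring
  rw [h1, det_sub_corners M hu, hsymm, hadj, ← hcos]
  linear_combination (M.det * (M⁻¹ 0 (Fin.last m) ^ 2 - M⁻¹ 0 0 * M⁻¹ (Fin.last m) (Fin.last m)))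
    * hexp

lemma det_eq_prod_eigenvalue (q : ℕ) (k : ℝ) (z : ℂ) :
    (z • 1 - truncation V q k).det = ∏ j : Fin q, (z - eigenvalue V q j k) := by
  have h1 : z • (1 : Matrix (Fin q) (Fin q) ℂ) - truncation V q k
      = Matrix.scalar (Fin q) z - truncation V q k := by
    rw [Matrix.scalar_apply, Matrix.smul_one_eq_diagonal]
  rw [h1, ← Matrix.eval_charpoly, (truncation_isHermitian V q k).charpoly_eq, Polynomial.eval_prod]
  simp only [Polynomial.eval_sub, Polynomial.eval_X, Polynomial.eval_C]
  refine Fintype.prod_equiv (((Fintype.equivOfCardEq (Fintype.card_fin _)).symm).trans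
    ((finCongr (Fintype.card_fin q)).trans Fin.revPerm)) _ _ fun i => ?_
  simp [eigenvalue, Matrix.IsHermitian.eigenvalues]

end HalfLine

/-! ### Thin bands force a large Floquet determinant. -/

namespace HalfLine
variable (V : ℓ^∞(ℕ+, ℝ))

/-- Compare `F' / F - 1`, of modulus exactly `4 / ‖F‖`, with the product of the factors `1 + f j`,
where `f j` is the shift of the `j`-th eigenvalue relative to its distance from `z`. -/
lemma norm_det_truncation_inv_le (m : ℕ) {b : ℝ} (hb : ∀ j, bandWidth V (m + 1) j ≤ b)
    {z : ℂ} (hz : 0 < z.im) (hsmall : (m + 1 : ℝ) * b ≤ z.im) :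
    ‖(z • 1 - truncation V (m + 1) 0).det‖⁻¹
      ≤ b / 2 * ∑ j, ‖z - eigenvalue V (m + 1) j 0‖⁻¹ := by
  have hb0 : 0 ≤ b := (abs_nonneg _).trans (hb 0)
  have him : ∀ j, z.im ≤ ‖z - eigenvalue V (m + 1) j 0‖ := fun j => by
    simpa using (le_abs_self _).trans (Complex.abs_im_le_norm (z - eigenvalue V (m + 1) j 0))
  have hpos : ∀ j, 0 < ‖z - eigenvalue V (m + 1) j 0‖ := fun j => hz.trans_le (him j)
  set F := (z • 1 - truncation V (m + 1) 0).det with hF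
  set F' := (z • 1 - truncation V (m + 1) Real.pi).det with hF'
  have hF0 : F ≠ 0 := (isUnit_det_smul_one_sub (truncation_isHermitian V _ _) hz).ne_zero
  have hdiff : ‖F' - F‖ = 4 := by
    have : F' - F = 4 * (shiftedDirichlet V (m + 1) z).adjugate 0 (Fin.last m) := by
      rw [hF, hF', det_truncation V m _ hz, det_truncation V m _ hz]
      simp
      ring
    rw [this, norm_mul, norm_adjugate_corner]
    simp
  set f : Fin (m + 1) → ℂ := fun j =>
    ((eigenvalue V (m + 1) j 0 : ℂ) - eigenvalue V (m + 1) j Real.pi) /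
      (z - eigenvalue V (m + 1) j 0) with hf
  have hprod : ∏ j, (1 + f j) = F' / F := by
    rw [hF, hF', det_eq_prod_eigenvalue, det_eq_prod_eigenvalue, ← Finset.prod_div_distrib]
    refine Finset.prod_congr rfl fun j _ => ?_
    have := norm_pos_iff.1 (hpos j)
    simp only [hf]
    field_simp
    ring
  have hfle : ∀ j, ‖f j‖ ≤ b * ‖z - eigenvalue V (m + 1) j 0‖⁻¹ := fun j => by
    rw [hf, norm_div, div_eq_mul_inv]
    gcongr
    rw [← Complex.ofReal_sub, Complex.norm_real, Real.norm_eq_abs, abs_sub_comm]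
    exact hb j
  have hsum : ∑ j, ‖f j‖ ≤ b * ∑ j, ‖z - eigenvalue V (m + 1) j 0‖⁻¹ := by
    rw [Finset.mul_sum]
    exact Finset.sum_le_sum fun j _ => hfle j
  have hle1 : b * ∑ j, ‖z - eigenvalue V (m + 1) j 0‖⁻¹ ≤ 1 := by
    calc b * ∑ j, ‖z - eigenvalue V (m + 1) j 0‖⁻¹
        ≤ b * ∑ _j : Fin (m + 1), z.im⁻¹ := by
          gcongr with j
          exact him j
      _ = (m + 1 : ℝ) * b / z.im := by
          simp
          ring
      _ ≤ 1 := (div_le_one hz).2 hsmall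
  -- The condition `q b ≤ Im z` keeps the sum at most 1, where the exponential is linearly
  -- controlled.
  have hexp : Real.exp (∑ j, ‖f j‖) - 1 ≤ 2 * ∑ j, ‖f j‖ := by
    have h0 : 0 ≤ ∑ j, ‖f j‖ := Finset.sum_nonneg fun _ _ => norm_nonneg _
    have := Real.abs_exp_sub_one_le (x := ∑ j, ‖f j‖) (by rw [abs_of_nonneg h0]; linarith)
    rw [abs_of_nonneg h0] at this
    exact (le_abs_self _).trans this
  have hmain : 4 * ‖F‖⁻¹ ≤ 2 * ∑ j, ‖f j‖ := by
    refine le_trans ?_ ((Finset.norm_prod_one_add_sub_one_le Finset.univ f).trans hexp)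
    rw [hprod, div_sub_one hF0, norm_div, hdiff, div_eq_mul_inv]
  linarith

/-- Cauchy–Schwarz over the `m + 1` eigenvalues produces Lorentzians, which can be integrated over
all energies. -/
lemma norm_det_truncation_inv_sq_le (m : ℕ) {b : ℝ} (hb : ∀ j, bandWidth V (m + 1) j ≤ b)
    {ε : ℝ} (hε : 0 < ε) (hsmall : (m + 1 : ℝ) * b ≤ ε) (E : ℝ) :
    (‖(((E : ℂ) + ε * Complex.I) • 1 - truncation V (m + 1) 0).det‖⁻¹) ^ 2
      ≤ b ^ 2 / 4 * (m + 1) *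
        ∑ j, ((E - eigenvalue V (m + 1) j 0) ^ 2 + ε ^ 2)⁻¹ := by
  have him : ((E : ℂ) + ε * Complex.I).im = ε := by simp
  have h := norm_det_truncation_inv_le V m hb (z := (E : ℂ) + ε * Complex.I)
    (by rwa [him]) (by rwa [him])
  have hsq : ∀ a : ℝ, (‖(E : ℂ) + ε * Complex.I - a‖⁻¹) ^ 2 = ((E - a) ^ 2 + ε ^ 2)⁻¹ := fun a => by
    rw [inv_pow, ← Complex.normSq_eq_norm_sq, Complex.normSq_apply]
    simp
    ring
  calc _ ≤ (b / 2 * ∑ j, ‖(E : ℂ) + ε * Complex.I - eigenvalue V (m + 1) j 0‖⁻¹) ^ 2 := by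
        gcongr
    _ = b ^ 2 / 4 * (∑ j, ‖(E : ℂ) + ε * Complex.I - eigenvalue V (m + 1) j 0‖⁻¹) ^ 2 := by ring
    _ ≤ b ^ 2 / 4 * ((m + 1) *
        ∑ j, (‖(E : ℂ) + ε * Complex.I - eigenvalue V (m + 1) j 0‖⁻¹) ^ 2) := by
        gcongr
        simpa using sq_sum_le_card_mul_sum_sq (s := Finset.univ)
          (f := fun j => ‖(E : ℂ) + ε * Complex.I - eigenvalue V (m + 1) j 0‖⁻¹)
    _ = _ := by
        simp only [hsq]
        ring

end HalfLine

/-! ### Self-adjointness of `H` and finite vectors extended by zero. -/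

namespace HalfLine

lemma inner_shiftRight (ψ φ : ℓ²(ℕ+, ℂ)) : inner ℂ ψ (shiftRight φ) = inner ℂ (shiftLeft ψ) φ := by
  have h := lp.hasSum_inner (𝕜 := ℂ) (shiftLeft ψ) φ
  have h' : HasSum (fun n => inner ℂ (ψ n) (prev φ n)) (inner ℂ (shiftLeft ψ) φ) := by
    rw [← (add_left_injective (1 : ℕ+)).hasSum_iff]
    · have e : (fun n => inner ℂ (ψ n) (prev φ n)) ∘ (fun n : ℕ+ => n + 1)
          = fun n => inner ℂ (shiftLeft ψ n) (φ n) := by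
        funext n
        have h : n + 1 ≠ 1 := PNat.add_one n ▸ (PNat.lt_add_left 1 n).ne'
        simp only [Function.comp_apply, prev, h, if_false, PNat.add_sub]
        rfl
      rw [e]
      exact h
    · intro n hn
      have : n = 1 := by
        by_contra h
        exact hn ⟨n - 1, PNat.sub_add_of_lt (lt_of_le_of_ne one_le (Ne.symm h))⟩
      simp [prev, this]
  exact (lp.hasSum_inner (𝕜 := ℂ) ψ (shiftRight φ)).unique h'

lemma schrodinger_isSymmetric (V : ℓ^∞(ℕ+, ℝ)) :
    (schrodinger V : ℓ²(ℕ+, ℂ) →ₗ[ℂ] ℓ²(ℕ+, ℂ)).IsSymmetric := by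
  intro ψ φ
  have hV : inner ℂ (mulPotential V ψ) φ = inner ℂ ψ (mulPotential V φ) := by
    rw [lp.inner_eq_tsum, lp.inner_eq_tsum]
    refine tsum_congr fun n => ?_
    change inner ℂ ((V n : ℂ) * ψ n) (φ n) = inner ℂ (ψ n) ((V n : ℂ) * φ n)
    simp
    ring
  have hR : inner ℂ (shiftRight ψ) φ = inner ℂ ψ (shiftLeft φ) := by
    rw [← inner_conj_symm, inner_shiftRight, inner_conj_symm]
  simp only [schrodinger, ContinuousLinearMap.coe_coe, add_apply,
    inner_add_left, inner_add_right, hV, hR, inner_shiftRight]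
  ring

lemma schrodinger_isSelfAdjoint (V : ℓ^∞(ℕ+, ℝ)) : IsSelfAdjoint (schrodinger V) :=
  ContinuousLinearMap.isSelfAdjoint_iff_isSymmetric.2 (schrodinger_isSymmetric V)

variable (V : ℓ^∞(ℕ+, ℝ))

lemma resolvent_bound {z : ℂ} (hz : 0 < z.im) (ψ : ℓ²(ℕ+, ℂ)) :
    ‖ψ‖ ≤ ‖z • ψ - schrodinger V ψ‖ / z.im := by
  rw [le_div_iff₀ hz, mul_comm]
  exact symmetric_im_mul_norm_le (schrodinger_isSymmetric V) z ψ

lemma resolvent_injective {z : ℂ} (hz : 0 < z.im) {ψ φ : ℓ²(ℕ+, ℂ)}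
    (h : z • ψ - schrodinger V ψ = z • φ - schrodinger V φ) : ψ = φ := by
  have := resolvent_bound V hz (ψ - φ)
  have h0 : z • (ψ - φ) - schrodinger V (ψ - φ) = 0 := by
    rw [map_sub, smul_sub, sub_sub_sub_comm, h, sub_self]
  rw [h0, norm_zero, zero_div] at this
  exact sub_eq_zero.1 (norm_le_zero_iff.1 this)

lemma delta_apply (n k : ℕ+) : delta n k = if k = n then 1 else 0 := by
  rw [delta, lp.single_apply, Pi.single_apply]

lemma norm_delta (n : ℕ+) : ‖delta n‖ = 1 := by
  simp [delta, lp.norm_single]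

lemma inner_delta (n : ℕ+) (ψ : ℓ²(ℕ+, ℂ)) : inner ℂ (delta n) ψ = ψ n := by
  rw [delta, lp.inner_single_left]
  simp

/-- Extension of a finite vector by zero. -/
def zeroExtend (q : ℕ) (x : Fin q → ℂ) (k : ℕ) : ℂ := if h : k < q then x ⟨k, h⟩ else 0

lemma zeroExtend_memℓp (q : ℕ) (x : Fin q → ℂ) :
    Memℓp (fun n : ℕ+ => zeroExtend q x n.natPred) 2 := by
  refine memℓp_gen (summable_of_ne_finset_zero
    (s := (Finset.range q).image Nat.succPNat) fun n hn => ?_)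
  have : ¬ n.natPred < q := fun h =>
    hn (Finset.mem_image.2 ⟨n.natPred, Finset.mem_range.2 h, PNat.succPNat_natPred n⟩)
  simp [zeroExtend, this]

/-- A vector on `{1, …, q}` as an element of `ℓ²(ℕ)`. -/
def extend (q : ℕ) (x : Fin q → ℂ) : ℓ²(ℕ+, ℂ) :=
  ⟨fun n => zeroExtend q x n.natPred, zeroExtend_memℓp q x⟩

lemma extend_apply (q : ℕ) (x : Fin q → ℂ) (n : ℕ+) : extend q x n = zeroExtend q x n.natPred := rfl

lemma extend_apply_eq_zero {q : ℕ} (x : Fin q → ℂ) {n : ℕ+} (hn : q < n) : extend q x n = 0 := by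
  have : ¬ n.natPred < q := by have := PNat.natPred_add_one n; omega
  simp [extend_apply, zeroExtend, this]

lemma extend_single (q : ℕ) (i : Fin q) :
    extend q (Pi.single i 1) = delta (Nat.succPNat i) := by
  ext n
  rw [extend_apply, delta_apply, zeroExtend]
  have : n = Nat.succPNat i ↔ n.natPred = i := by
    constructor
    · rintro rfl; simp
    · intro h; rw [← h, PNat.succPNat_natPred]
  by_cases h : n.natPred < q
  · simp [h, this, Pi.single_apply, Fin.ext_iff]
  · have h2 : n.natPred ≠ i := fun h' => h (h' ▸ i.2)
    simp [h, this, h2]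

lemma shiftedDirichlet_mulVec (q : ℕ) (z : ℂ) (x : Fin q → ℂ) (i : Fin q) :
    (shiftedDirichlet V q z).mulVec x i =
      z * x i - (zeroExtend q x (i + 1) + (if (i : ℕ) = 0 then 0 else zeroExtend q x (i - 1))
        + V (Nat.succPNat i) * x i) := by
  have h1 : ∑ j : Fin q, (if (i : ℕ) + 1 = j then 1 else 0) * x j = zeroExtend q x (i + 1) := by
    by_cases h : (i : ℕ) + 1 < q
    · rw [Finset.sum_eq_single ⟨i + 1, h⟩]
      · simp [zeroExtend, h]
      · intro j _ hj
        rw [if_neg (fun h' => hj (Fin.ext h'.symm)), zero_mul]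
      · simp
    · rw [Finset.sum_eq_zero]
      · simp [zeroExtend, h]
      · intro j _
        rw [if_neg (fun h' : (i : ℕ) + 1 = j => h (h' ▸ j.2)), zero_mul]
  have h2 : ∑ j : Fin q, (if (j : ℕ) + 1 = i then 1 else 0) * x j
      = if (i : ℕ) = 0 then 0 else zeroExtend q x (i - 1) := by
    by_cases h : (i : ℕ) = 0
    · rw [if_pos h, Finset.sum_eq_zero]
      intro j _
      rw [if_neg (by omega), zero_mul]
    · have hi : (i : ℕ) - 1 < q := by omega
      rw [if_neg h, Finset.sum_eq_single ⟨i - 1, hi⟩]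
      · have : (i : ℕ) - 1 + 1 = i := by omega
        simp [zeroExtend, hi, this]
      · intro j _ hj
        rw [if_neg (fun h' => hj (Fin.ext (by simp; omega))), zero_mul]
      · simp
  have h3 : ∑ j : Fin q, (if i = j then (V (Nat.succPNat i) : ℂ) else 0) * x j
      = V (Nat.succPNat i) * x i := by
    simp
  rw [shiftedDirichlet, Matrix.sub_mulVec, Matrix.smul_mulVec, Matrix.one_mulVec, Pi.sub_apply,
    Pi.smul_apply, smul_eq_mul, ← h1, ← h2, ← h3, ← Finset.sum_add_distrib,
    ← Finset.sum_add_distrib]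
  congr 1
  change ∑ j, dirichlet V q i j * x j = _
  refine Finset.sum_congr rfl fun j _ => ?_
  rw [dirichlet]
  ring

/-- Cutting `H` at `q = m + 1` removes only the bond from `q` to `q + 1`, so the error sits at the
single site `q + 1`. -/
lemma sub_schrodinger_extend (m : ℕ) (z : ℂ) (x : Fin (m + 1) → ℂ) :
    z • extend (m + 1) x - schrodinger V (extend (m + 1) x)
      = extend (m + 1) ((shiftedDirichlet V (m + 1) z).mulVec x)
        - x (Fin.last m) • delta (Nat.succPNat (m + 1)) := by
  ext n
  obtain ⟨k, rfl⟩ : ∃ k : ℕ, n = Nat.succPNat k := ⟨n.natPred, (PNat.succPNat_natPred n).symm⟩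
  have hprev : (if Nat.succPNat k = 1 then 0 else extend (m + 1) x (Nat.succPNat k - 1))
      = if k = 0 then 0 else zeroExtend (m + 1) x (k - 1) := by
    cases k with
    | zero => rfl
    | succ k =>
      have h1 : Nat.succPNat (k + 1) ≠ 1 := fun h => by
        have := congrArg PNat.val h
        simp at this
      have h2 : Nat.succPNat (k + 1) - 1 = Nat.succPNat k := by
        apply PNat.eq
        rw [PNat.sub_coe, if_pos]
        · simp
        · exact PNat.coe_lt_coe _ _ |>.1 (by simp)
      rw [if_neg h1, h2]
      simp [extend_apply]
  have hnext : extend (m + 1) x (Nat.succPNat k + 1) = zeroExtend (m + 1) x (k + 1) := by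
    rw [extend_apply]; congr 1
  have hself : ∀ y, extend (m + 1) y (Nat.succPNat k) = zeroExtend (m + 1) y k := fun y => by
    rw [extend_apply, Nat.natPred_succPNat]
  have hd : delta (Nat.succPNat (m + 1)) (Nat.succPNat k) = if k = m + 1 then 1 else 0 := by
    rw [delta_apply]
    simp [Nat.succPNat_inj]
  change z * extend (m + 1) x (Nat.succPNat k) - schrodinger V (extend (m + 1) x) (Nat.succPNat k)
    = extend (m + 1) ((shiftedDirichlet V (m + 1) z).mulVec x) (Nat.succPNat k)
      - x (Fin.last m) * delta (Nat.succPNat (m + 1)) (Nat.succPNat k)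
  rw [schrodinger_apply, hprev, hnext, hself, hself, hd]
  rcases lt_trichotomy k (m + 1) with h | h | h
  · have hv : zeroExtend (m + 1) x k = x ⟨k, h⟩ := by simp [zeroExtend, h]
    have hv' : zeroExtend (m + 1) ((shiftedDirichlet V (m + 1) z).mulVec x) k
      = (shiftedDirichlet V (m + 1) z).mulVec x ⟨k, h⟩ := by simp [zeroExtend, h]
    rw [hv, hv', shiftedDirichlet_mulVec, if_neg h.ne]
    ring
  · subst h
    simp [zeroExtend]
    rfl
  · have h1 : ¬ k < m + 1 := by omega
    have h2 : ¬ k + 1 < m + 1 := by omega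
    have h3 : ¬ k - 1 < m + 1 := by omega
    simp [zeroExtend, h1, h2, h3, h.ne']

end HalfLine

/-! ### The resolvent as Laplace transform of the evolution. -/

namespace HalfLine
open MeasureTheory FourierTransform Filter Topology
variable (V : ℓ^∞(ℕ+, ℝ))

lemma norm_evolution_apply (t : ℝ) (ψ : ℓ²(ℕ+, ℂ)) : ‖evolution V t ψ‖ = ‖ψ‖ := by
  refine ContinuousLinearMap.norm_map_of_mem_unitary ?_ ψ
  let _ : NormedAlgebra ℚ (ℓ²(ℕ+, ℂ) →L[ℂ] ℓ²(ℕ+, ℂ)) := .restrictScalars ℚ ℂ _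
  refine NormedSpace.exp_mem_unitary_of_mem_skewAdjoint ?_
  refine (schrodinger_isSelfAdjoint V).smul_mem_skewAdjoint ?_
  rw [skewAdjoint.mem_iff]
  simp

lemma hasDerivAt_evolution (t : ℝ) (ψ : ℓ²(ℕ+, ℂ)) :
    HasDerivAt (fun s => evolution V s ψ) (-Complex.I • schrodinger V (evolution V t ψ)) t := by
  have h := ((hasDerivAt_exp_smul_const' (𝕂 := ℂ) ((-Complex.I) • schrodinger V) (t : ℂ)).clm_apply
    (hasDerivAt_const (t : ℂ) ψ)).scomp t Complex.ofRealCLM.hasDerivAt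
  have e : ∀ s : ℝ, NormedSpace.exp ((s : ℂ) • (-Complex.I) • schrodinger V) = evolution V s := by
    intro s
    rw [evolution, smul_smul]
    congr 2
    ring
  have e1 : (fun s : ℂ => NormedSpace.exp (s • (-Complex.I) • schrodinger V) ψ) ∘ Complex.ofReal
      = fun s => evolution V s ψ := funext fun s => by rw [Function.comp_apply, e]
  rw [e1, e] at h
  simpa using h

lemma continuous_evolution (ψ : ℓ²(ℕ+, ℂ)) : Continuous fun t => evolution V t ψ :=
  continuous_iff_continuousAt.2 fun t => (hasDerivAt_evolution V t ψ).continuousAt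

/-- The integrand `e^{izt} e^{-itH} ψ` of the Laplace transform of the evolution. -/
noncomputable def laplaceIntegrand (z : ℂ) (ψ : ℓ²(ℕ+, ℂ)) (t : ℝ) : ℓ²(ℕ+, ℂ) :=
  Complex.exp (Complex.I * z * t) • evolution V t ψ

lemma norm_laplaceIntegrand (z : ℂ) (ψ : ℓ²(ℕ+, ℂ)) (t : ℝ) :
    ‖laplaceIntegrand V z ψ t‖ = Real.exp (-z.im * t) * ‖ψ‖ := by
  rw [laplaceIntegrand, norm_smul, norm_evolution_apply, Complex.norm_exp]
  simp

lemma continuous_laplaceIntegrand (z : ℂ) (ψ : ℓ²(ℕ+, ℂ)) : Continuous (laplaceIntegrand V z ψ) := by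
  have := continuous_evolution V ψ
  unfold laplaceIntegrand
  fun_prop

lemma integrableOn_laplaceIntegrand {z : ℂ} (hz : 0 < z.im) (ψ : ℓ²(ℕ+, ℂ)) :
    IntegrableOn (laplaceIntegrand V z ψ) (Set.Ioi 0) := by
  have h := (exp_neg_integrableOn_Ioi 0 hz).mul_const ‖ψ‖
  refine Integrable.mono' h (continuous_laplaceIntegrand V z ψ).aestronglyMeasurable
    (Eventually.of_forall fun t => ?_)
  rw [norm_laplaceIntegrand]

/-- The Laplace transform of the evolution, a multiple of the resolvent. -/
noncomputable def laplace (z : ℂ) (ψ : ℓ²(ℕ+, ℂ)) : ℓ²(ℕ+, ℂ) :=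
  -Complex.I • ∫ t in Set.Ioi (0 : ℝ), laplaceIntegrand V z ψ t

/-- Identifies `laplace V z` as `(z - H)⁻¹`: the integrand has derivative `i (z - H)` applied to
itself, equals `ψ` at time 0 and decays at infinity. -/
lemma sub_schrodinger_laplace {z : ℂ} (hz : 0 < z.im) (ψ : ℓ²(ℕ+, ℂ)) :
    z • laplace V z ψ - schrodinger V (laplace V z ψ) = ψ := by
  have hint := integrableOn_laplaceIntegrand V hz ψ
  set A : ℓ²(ℕ+, ℂ) →L[ℂ] ℓ²(ℕ+, ℂ) := z • ContinuousLinearMap.id ℂ _ - schrodinger V with hA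
  have hderiv : ∀ t : ℝ, HasDerivAt (laplaceIntegrand V z ψ)
      (Complex.I • A (laplaceIntegrand V z ψ t)) t := fun t => by
    have h1 : HasDerivAt (fun s : ℝ => Complex.exp (Complex.I * z * s))
        (Complex.exp (Complex.I * z * t) * (Complex.I * z)) t := by
      have : HasDerivAt (fun s : ℂ => Complex.I * z * s) (Complex.I * z) (t : ℂ) := by
        simpa using (hasDerivAt_id (t : ℂ)).const_mul (Complex.I * z)
      exact this.cexp.comp_ofReal
    refine (h1.smul (hasDerivAt_evolution V t ψ)).congr_deriv (Eq.symm ?_)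
    change Complex.I • (z • laplaceIntegrand V z ψ t - schrodinger V (laplaceIntegrand V z ψ t)) = _
    rw [laplaceIntegrand, map_smul]
    module
  have hlim : Tendsto (laplaceIntegrand V z ψ) atTop (𝓝 0) := by
    rw [tendsto_zero_iff_norm_tendsto_zero]
    simp only [norm_laplaceIntegrand]
    have : Tendsto (fun t : ℝ => -z.im * t) atTop atBot :=
      tendsto_id.const_mul_atTop_of_neg (neg_lt_zero.2 hz)
    simpa using (Real.tendsto_exp_atBot.comp this).mul_const ‖ψ‖
  have hftc := integral_Ioi_of_hasDerivAt_of_tendsto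
    (continuous_laplaceIntegrand V z ψ).continuousWithinAt (fun t _ => hderiv t)
    ((A.integrable_comp hint).smul Complex.I) hlim
  have h0 : laplaceIntegrand V z ψ 0 = ψ := by simp [laplaceIntegrand, evolution]
  rw [integral_smul, A.integral_comp_comm hint, h0] at hftc
  have : A (laplace V z ψ) = ψ := by
    rw [laplace, map_smul, neg_smul, hftc]
    simp
  simpa [hA] using this

/-- `1_{t > 0} e^{-εt} ⟨δ_n, e^{-itH} ψ⟩`. -/
noncomputable def dampedAmplitude (ε : ℝ) (ψ : ℓ²(ℕ+, ℂ)) (n : ℕ+) : ℝ → ℂ :=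
  (Set.Ioi 0).indicator fun t => (Real.exp (-ε * t) : ℂ) * evolution V t ψ n

lemma continuous_evolution_apply (ψ : ℓ²(ℕ+, ℂ)) (n : ℕ+) :
    Continuous fun t => evolution V t ψ n := by
  simp only [← inner_delta n]
  exact continuous_const.inner (continuous_evolution V ψ)

lemma norm_dampedAmplitude_le (ε : ℝ) (ψ : ℓ²(ℕ+, ℂ)) (n : ℕ+) (t : ℝ) :
    ‖dampedAmplitude V ε ψ n t‖ ≤ (Set.Ioi 0).indicator (fun t => Real.exp (-ε * t) * ‖ψ‖) t := by
  rw [dampedAmplitude, norm_indicator_eq_indicator_norm]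
  refine Set.indicator_le_indicator ?_
  rw [norm_mul, Complex.norm_real, Real.norm_of_nonneg (Real.exp_nonneg _)]
  gcongr
  exact (lp.norm_apply_le_norm two_ne_zero _ n).trans (norm_evolution_apply V t ψ).le

lemma aestronglyMeasurable_dampedAmplitude (ε : ℝ) (ψ : ℓ²(ℕ+, ℂ)) (n : ℕ+) :
    AEStronglyMeasurable (dampedAmplitude V ε ψ n) := by
  refine AEStronglyMeasurable.indicator ?_ measurableSet_Ioi
  have := continuous_evolution_apply V ψ n
  exact Continuous.aestronglyMeasurable (by fun_prop)

lemma integrable_dampedAmplitude {ε : ℝ} (hε : 0 < ε) (ψ : ℓ²(ℕ+, ℂ)) (n : ℕ+) :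
    Integrable (dampedAmplitude V ε ψ n) := by
  refine Integrable.mono' (g := (Set.Ioi 0).indicator (fun t => Real.exp (-ε * t) * ‖ψ‖)) ?_
    (aestronglyMeasurable_dampedAmplitude V ε ψ n)
    (Eventually.of_forall (norm_dampedAmplitude_le V ε ψ n))
  exact IntegrableOn.integrable_indicator ((exp_neg_integrableOn_Ioi 0 hε).mul_const ‖ψ‖)
    measurableSet_Ioi

lemma memLp_dampedAmplitude {ε : ℝ} (hε : 0 < ε) (ψ : ℓ²(ℕ+, ℂ)) (n : ℕ+) :
    MemLp (dampedAmplitude V ε ψ n) 2 := by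
  rw [memLp_two_iff_integrable_sq_norm (aestronglyMeasurable_dampedAmplitude V ε ψ n)]
  refine ((integrable_dampedAmplitude V hε ψ n).norm.const_mul ‖ψ‖).mono'
    ((aestronglyMeasurable_dampedAmplitude V ε ψ n).norm.pow 2) (Eventually.of_forall fun t => ?_)
  have h1 : ‖dampedAmplitude V ε ψ n t‖ ≤ ‖ψ‖ := by
    refine (norm_dampedAmplitude_le V ε ψ n t).trans ?_
    refine Set.indicator_apply_le' (fun ht => ?_) fun _ => norm_nonneg _
    have ht' : 0 < t := ht
    refine mul_le_of_le_one_left (norm_nonneg _) (Real.exp_le_one_iff.2 ?_)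
    nlinarith
  rw [Real.norm_of_nonneg (by positivity), sq]
  gcongr

lemma integral_dampedAmplitude_sq (ε : ℝ) (ψ : ℓ²(ℕ+, ℂ)) (n : ℕ+) :
    ∫ t, ‖dampedAmplitude V ε ψ n t‖ ^ 2
      = ∫ t in Set.Ioi (0 : ℝ), ‖inner ℂ (delta n) (evolution V t ψ)‖ ^ 2
        * Real.exp (-2 * ε * t) := by
  rw [← integral_indicator measurableSet_Ioi]
  refine integral_congr_ae (Eventually.of_forall fun t => ?_)
  by_cases ht : t ∈ Set.Ioi (0 : ℝ)
  · simp only [dampedAmplitude, Set.indicator_of_mem ht, inner_delta]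
    rw [norm_mul, mul_pow, Complex.norm_real, Real.norm_of_nonneg (Real.exp_nonneg _),
      ← Real.exp_nat_mul, mul_comm]
    congr 2
    push_cast
    ring
  · simp [dampedAmplitude, Set.indicator_of_notMem ht]

/-- The frequency `ξ` corresponds to the energy `E = -2πξ`, and the damping rate becomes the
imaginary part. -/
lemma fourier_dampedAmplitude {ε : ℝ} (hε : 0 < ε) (ψ : ℓ²(ℕ+, ℂ)) (n : ℕ+) (ξ : ℝ) :
    𝓕 (dampedAmplitude V ε ψ n) ξ
      = Complex.I * laplace V (((-(2 * Real.pi * ξ) : ℝ) : ℂ) + ε * Complex.I) ψ n := by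
  set z : ℂ := ((-(2 * Real.pi * ξ) : ℝ) : ℂ) + ε * Complex.I with hz
  have him : 0 < z.im := by simpa [hz] using hε
  have h1 : Complex.I * laplace V z ψ n
      = ∫ t in Set.Ioi (0 : ℝ), inner ℂ (delta n) (laplaceIntegrand V z ψ t) := by
    rw [integral_inner (integrableOn_laplaceIntegrand V him ψ), inner_delta, laplace,
      lp.coeFn_smul, Pi.smul_apply, smul_eq_mul, ← mul_assoc]
    simp
  rw [h1, Real.fourier_real_eq_integral_exp_smul, ← integral_indicator measurableSet_Ioi]
  refine integral_congr_ae (Eventually.of_forall fun t => ?_)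
  by_cases ht : t ∈ Set.Ioi (0 : ℝ)
  · simp only [dampedAmplitude, Set.indicator_of_mem ht, inner_delta, laplaceIntegrand,
      lp.coeFn_smul, Pi.smul_apply, smul_eq_mul]
    rw [← mul_assoc, Complex.ofReal_exp, ← Complex.exp_add]
    congr 2
    rw [hz]
    push_cast
    linear_combination (-(ε * t : ℂ)) * Complex.I_sq
  · simp [dampedAmplitude, Set.indicator_of_notMem ht]

end HalfLine

/-! ### Resolvent decay beyond `q` and the tail probability. -/

namespace HalfLine
open MeasureTheory FourierTransform Filter Topology
variable (V : ℓ^∞(ℕ+, ℝ))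

/-- To get past `q`, a wave started inside must cross the bond from `q` to `q + 1`; the finite
Dirichlet resolvent gives its amplitude there. -/
lemma laplace_delta_apply_tail (m : ℕ) {z : ℂ} (hz : 0 < z.im) (j : Fin (m + 1)) {n : ℕ+}
    (hn : m + 1 < (n : ℕ)) :
    laplace V z (delta (Nat.succPNat j)) n
      = (shiftedDirichlet V (m + 1) z)⁻¹ (Fin.last m) j
        * laplace V z (delta (Nat.succPNat (m + 1))) n := by
  set M := shiftedDirichlet V (m + 1) z with hM
  have hu : IsUnit M.det := isUnit_det_smul_one_sub (dirichlet_isHermitian V _) hz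
  have h := sub_schrodinger_extend V m z (M⁻¹.mulVec (Pi.single j 1))
  rw [← hM, Matrix.mulVec_mulVec, Matrix.mul_nonsing_inv _ hu, Matrix.one_mulVec,
    extend_single] at h
  have hg : laplace V z (delta (Nat.succPNat j)) = extend (m + 1) (M⁻¹.mulVec (Pi.single j 1))
      + M⁻¹ (Fin.last m) j • laplace V z (delta (Nat.succPNat (m + 1))) := by
    refine resolvent_injective V hz ?_
    have h2 := sub_schrodinger_laplace V hz (delta (Nat.succPNat (m + 1)))
    rw [sub_schrodinger_laplace V hz, map_add, map_smul, smul_add, add_sub_add_comm, h,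
      smul_comm, ← smul_sub, h2, Matrix.mulVec_single_one, Matrix.col_apply]
    simp
  rw [hg, lp.coeFn_add, Pi.add_apply, extend_apply_eq_zero _ (by exact_mod_cast hn), zero_add]
  rfl

lemma norm_laplace_le {z : ℂ} (hz : 0 < z.im) (n : ℕ+) : ‖laplace V z (delta n)‖ ≤ 1 / z.im := by
  have := resolvent_bound V hz (laplace V z (delta n))
  rwa [sub_schrodinger_laplace V hz, norm_delta] at this

/-- `F` contains `det M`, which has no useful bound. Multiplied by `G(n, 1)` it appears only as the
adjugate corner `a`, of modulus one, and the remaining products with `w` are again resolvent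
entries. -/
lemma exists_tail_vector (m : ℕ) {z : ℂ} (hz : 0 < z.im) (hz1 : z.im ≤ 1) :
    ∃ Ψ : ℓ²(ℕ+, ℂ), ‖Ψ‖ ≤ 5 / z.im ^ 2 ∧ ∀ n : ℕ+, m + 1 < (n : ℕ) →
      (z • 1 - truncation V (m + 1) 0).det * laplace V z (delta 1) n = Ψ n := by
  set M := shiftedDirichlet V (m + 1) z with hM
  have hA := dirichlet_isHermitian V (m + 1)
  have hu : IsUnit M.det := isUnit_det_smul_one_sub hA hz
  set a := M.adjugate 0 (Fin.last m) with ha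
  have ha1 : ‖a‖ = 1 := norm_adjugate_corner V m z
  have hp : ‖M⁻¹ 0 (Fin.last m)‖ ≤ 1 / z.im := norm_inv_apply_le hA hz _ _
  have hs : ‖M⁻¹ 0 0‖ ≤ 1 / z.im := norm_inv_apply_le hA hz _ _
  have hsymm : M⁻¹ (Fin.last m) 0 = M⁻¹ 0 (Fin.last m) := by
    have := congrArg (fun X => X 0 (Fin.last m)) (Matrix.transpose_nonsing_inv M)
    rw [hM, shiftedDirichlet_transpose] at this
    exact this
  have hadj : a = M.det * M⁻¹ 0 (Fin.last m) := by
    rw [ha, Matrix.inv_def, Matrix.smul_apply, smul_eq_mul, ← mul_assoc,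
      Ring.mul_inverse_cancel _ hu, one_mul]
  set w := laplace V z (delta (Nat.succPNat (m + 1))) with hw
  set g := laplace V z (delta 1) with hg
  set y := laplace V z (delta (Nat.succPNat m)) with hy
  -- Beyond `q`, `g` and `y` are multiples of `w`. Absorbing these factors leaves at most two
  -- resolvent factors per term, and the coefficients 1, 1, 1, 2 add up to the 5.
  refine ⟨a • (w + M⁻¹ 0 (Fin.last m) • g - M⁻¹ 0 0 • y - (2 : ℂ) • g), ?_, fun n hn => ?_⟩
  · have hwn : ‖w‖ ≤ 1 / z.im := norm_laplace_le V hz _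
    have hgn : ‖g‖ ≤ 1 / z.im := norm_laplace_le V hz _
    have hyn : ‖y‖ ≤ 1 / z.im := norm_laplace_le V hz _
    have hi : 1 / z.im ≤ (1 / z.im) ^ 2 := by
      have : 1 ≤ 1 / z.im := by rwa [le_div_iff₀ hz, one_mul]
      nlinarith
    rw [norm_smul, ha1, one_mul]
    calc _ ≤ ‖w‖ + ‖M⁻¹ 0 (Fin.last m)‖ * ‖g‖ + ‖M⁻¹ 0 0‖ * ‖y‖ + 2 * ‖g‖ := by
          refine (norm_sub_le _ _).trans (add_le_add ((norm_sub_le _ _).trans (add_le_add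
            ((norm_add_le _ _).trans (add_le_add le_rfl ?_)) ?_)) ?_)
          · exact (norm_smul _ _).le
          · exact (norm_smul _ _).le
          · rw [norm_smul]; simp
      _ ≤ 1 / z.im + 1 / z.im * (1 / z.im) + 1 / z.im * (1 / z.im) + 2 * (1 / z.im) := by
          gcongr
      _ ≤ 5 * (1 / z.im) ^ 2 := by linarith
      _ = 5 / z.im ^ 2 := by rw [one_div, inv_pow, div_eq_mul_inv]
  · have h1 : g n = M⁻¹ 0 (Fin.last m) * w n := by
      rw [← hsymm]
      exact laplace_delta_apply_tail V m hz 0 hn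
    have h2 : y n = M⁻¹ (Fin.last m) (Fin.last m) * w n :=
      laplace_delta_apply_tail V m hz (Fin.last m) hn
    change _ = a * (w n + M⁻¹ 0 (Fin.last m) * g n - M⁻¹ 0 0 * y n - 2 * g n)
    rw [det_truncation V m 0 hz, ← hM, ← ha, h1, h2, hadj]
    simp
    ring

lemma sum_norm_sq_laplace_le (m : ℕ) {z : ℂ} (hz : 0 < z.im) (hz1 : z.im ≤ 1)
    (s : Finset ℕ+) (hs : ∀ n ∈ s, m + 1 < (n : ℕ)) :
    ∑ n ∈ s, ‖laplace V z (delta 1) n‖ ^ 2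
      ≤ 25 / z.im ^ 4 * (‖(z • 1 - truncation V (m + 1) 0).det‖⁻¹) ^ 2 := by
  obtain ⟨Ψ, hΨ, h⟩ := exists_tail_vector V m hz hz1
  set F := (z • 1 - truncation V (m + 1) 0).det with hF
  have hF0 : F ≠ 0 := (isUnit_det_smul_one_sub (truncation_isHermitian V _ _) hz).ne_zero
  have h1 : ∀ n ∈ s, ‖laplace V z (delta 1) n‖ ^ 2 = ‖Ψ n‖ ^ 2 * (‖F‖⁻¹) ^ 2 := fun n hn => by
    rw [← h n (hs n hn), norm_mul]
    have := norm_ne_zero_iff.2 hF0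
    field_simp
  rw [Finset.sum_congr rfl h1, ← Finset.sum_mul]
  gcongr
  have h2 := lp.sum_rpow_le_norm_rpow (p := 2) (by norm_num) Ψ s
  simp only [ENNReal.toReal_ofNat, Real.rpow_ofNat] at h2
  calc _ ≤ ‖Ψ‖ ^ 2 := h2
    _ ≤ (5 / z.im ^ 2) ^ 2 := by gcongr
    _ = 25 / z.im ^ 4 := by ring

lemma integral_dampedAmplitude_sq_eq {ε : ℝ} (hε : 0 < ε) (n : ℕ+) :
    Integrable (fun ξ : ℝ =>
        ‖laplace V (((-(2 * Real.pi * ξ) : ℝ) : ℂ) + ε * Complex.I) (delta 1) n‖ ^ 2) ∧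
      ∫ ξ : ℝ, ‖laplace V (((-(2 * Real.pi * ξ) : ℝ) : ℂ) + ε * Complex.I) (delta 1) n‖ ^ 2
        = ∫ t, ‖dampedAmplitude V ε (delta 1) n t‖ ^ 2 := by
  obtain ⟨hm, hi⟩ := plancherel (integrable_dampedAmplitude V hε (delta 1) n)
    (memLp_dampedAmplitude V hε (delta 1) n)
  have e : ∀ ξ, ‖𝓕 (dampedAmplitude V ε (delta 1) n) ξ‖ ^ 2
      = ‖laplace V (((-(2 * Real.pi * ξ) : ℝ) : ℂ) + ε * Complex.I) (delta 1) n‖ ^ 2 := fun ξ => by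
    rw [fourier_dampedAmplitude V hε]
    simp
  have hm2 := (memLp_two_iff_integrable_sq_norm hm.1).1 hm
  simp only [e] at hm2 hi
  exact ⟨hm2, hi⟩

lemma sum_integral_dampedAmplitude_le (m : ℕ) {b ε : ℝ} (hb : ∀ j, bandWidth V (m + 1) j ≤ b)
    (hε : 0 < ε) (hε1 : ε ≤ 1) (hsmall : (m + 1 : ℝ) * b ≤ ε)
    (s : Finset ℕ+) (hs : ∀ n ∈ s, m + 1 < (n : ℕ)) :
    ∑ n ∈ s, ∫ t, ‖dampedAmplitude V ε (delta 1) n t‖ ^ 2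
      ≤ 25 / 8 * ((m + 1) ^ 2 * b ^ 2) / ε ^ 5 := by
  have hint : ∀ a : ℝ, Integrable (fun ξ : ℝ => ((-(2 * Real.pi) * ξ - a) ^ 2 + ε ^ 2)⁻¹) :=
    fun a => (integral_inv_sq_add_sq a hε).1.comp_mul_left'
      (neg_ne_zero.2 Real.two_pi_pos.ne')
  -- The Lorentzian has mass `π / ε` in `E`, and passing to `ξ` divides it by `2π`.
  have hval : ∀ a : ℝ, ∫ ξ : ℝ, ((-(2 * Real.pi) * ξ - a) ^ 2 + ε ^ 2)⁻¹ = 1 / (2 * ε) := by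
    intro a
    rw [Measure.integral_comp_mul_left (fun E : ℝ => ((E - a) ^ 2 + ε ^ 2)⁻¹),
      (integral_inv_sq_add_sq a hε).2, abs_inv, abs_neg, abs_of_pos Real.two_pi_pos, smul_eq_mul]
    have := Real.pi_pos
    field_simp
  simp only [← (integral_dampedAmplitude_sq_eq V hε _).2]
  rw [← integral_finsetSum _ fun n _ => (integral_dampedAmplitude_sq_eq V hε n).1]
  calc _ ≤ ∫ ξ : ℝ, 25 / ε ^ 4 * (b ^ 2 / 4 * (m + 1) *
        ∑ j, ((-(2 * Real.pi) * ξ - eigenvalue V (m + 1) j 0) ^ 2 + ε ^ 2)⁻¹) := by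
        refine integral_mono (integrable_finsetSum _ fun n _ =>
          (integral_dampedAmplitude_sq_eq V hε n).1)
          (((integrable_finsetSum _ fun j _ => hint _).const_mul _).const_mul _) fun ξ => ?_
        have him : (((-(2 * Real.pi * ξ) : ℝ) : ℂ) + ε * Complex.I).im = ε := by simp
        have h1 := sum_norm_sq_laplace_le V m (z := ((-(2 * Real.pi * ξ) : ℝ) : ℂ) + ε * Complex.I)
          (by rwa [him]) (by rwa [him]) s hs
        have h2 := norm_det_truncation_inv_sq_le V m hb hε hsmall (-(2 * Real.pi * ξ))
        rw [him] at h1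
        refine h1.trans ?_
        simp only [neg_mul]
        gcongr
    _ = _ := by
        rw [integral_const_mul, integral_const_mul, integral_finsetSum _ fun j _ => hint _]
        simp only [hval]
        simp
        field_simp
        ring

/-- Needed because `Real.log 0 = 0`: a vanishing tail probability would give rate 0. If all
amplitudes beyond `N` vanished, `G δ₁` would have finite support, which the recurrence excludes. -/
lemma exists_dampedAmplitude_ne_zero {ε : ℝ} (hε : 0 < ε) (N : ℕ) :
    ∃ n : ℕ+, N < (n : ℕ) ∧ 0 < ∫ t, ‖dampedAmplitude V ε (delta 1) n t‖ ^ 2 := by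
  by_contra! hcon
  set z : ℂ := ((-(2 * Real.pi * 0) : ℝ) : ℂ) + ε * Complex.I with hz
  have him : 0 < z.im := by simpa [hz] using hε
  set g := laplace V z (delta 1) with hg
  have htail : ∀ n : ℕ+, N < (n : ℕ) → g n = 0 := fun n hn => by
    have h0 : ∫ t, ‖dampedAmplitude V ε (delta 1) n t‖ ^ 2 = 0 :=
      le_antisymm (hcon n hn) (integral_nonneg fun t => by positivity)
    rw [integral_eq_zero_iff_of_nonneg (fun t => by positivity)
      ((memLp_two_iff_integrable_sq_norm (aestronglyMeasurable_dampedAmplitude V ε _ n)).1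
        (memLp_dampedAmplitude V hε _ n))] at h0
    have h1 : dampedAmplitude V ε (delta 1) n =ᵐ[volume] 0 := by
      filter_upwards [h0] with t ht
      simpa using ht
    have h2 := Real.fourier_congr_ae h1 0
    rw [fourier_dampedAmplitude V hε] at h2
    have h3 : 𝓕 (0 : ℝ → ℂ) 0 = 0 := by simp [Real.fourier_real_eq]
    rw [h3] at h2
    exact (mul_eq_zero.1 h2).resolve_left Complex.I_ne_zero
  have hres := sub_schrodinger_laplace V him (delta 1)
  rw [← hg] at hres
  have hcomp : ∀ n : ℕ+, z * g n - (g (n + 1) + (if n = 1 then 0 else g (n - 1)) + V n * g n)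
      = if n = 1 then 1 else 0 := fun n => by
    rw [← delta_apply 1 n, ← hres, ← schrodinger_apply]
    rfl
  -- The equation at `n + 1` has no source and expresses `g n` through `g (n + 1)` and `g (n + 2)`,
  -- so zeros propagate down to site 1, where the source `δ₁` contradicts them.
  have hback : ∀ j : ℕ, ∀ n : ℕ+, N < (n : ℕ) + j → g n = 0 := by
    intro j
    induction j with
    | zero => exact fun n hn => htail n hn
    | succ j ih =>
      intro n hn
      have h1 : n + 1 ≠ 1 := PNat.add_one n ▸ (PNat.lt_add_left 1 n).ne'
      have h2 := hcomp (n + 1)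
      rw [if_neg h1, if_neg h1, PNat.add_sub, ih (n + 1) (by rw [PNat.add_coe]; simp; omega),
        ih (n + 1 + 1) (by rw [PNat.add_coe, PNat.add_coe]; simp; omega)] at h2
      simpa using h2
  have hall : ∀ n : ℕ+, g n = 0 := fun n => hback (N + 1) n (by omega)
  have := hcomp 1
  simp [hall] at this

/-- If the bands of length `q` are shorter than `b`, with `q b T ≤ 1`, then beyond `q` the tail
probability is at most of order `T⁴ q² b²`. -/
lemma tailProb_bounds (q : ℕ) (hq : 0 < q) {b T x : ℝ} (hb : ∀ j, bandWidth V q j ≤ b)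
    (hT : 1 ≤ T) (hsmall : q * b * T ≤ 1) (hx : (q : ℝ) ≤ x) :
    0 < tailProb V x T ∧ tailProb V x T ≤ 25 / 4 * (T ^ 4 * (q ^ 2 * b ^ 2)) := by
  obtain ⟨m, rfl⟩ : ∃ m, q = m + 1 := ⟨q - 1, by omega⟩
  have hT0 : 0 < T := by linarith
  have hε : 0 < 1 / T := by positivity
  have hε1 : 1 / T ≤ 1 := by rwa [div_le_one hT0]
  have hs' : (m + 1 : ℝ) * b ≤ 1 / T := by
    rw [le_div_iff₀ hT0]
    exact_mod_cast hsmall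
  have hterm : ∀ n : ℕ+, 2 / T * ∫ t in Set.Ioi (0 : ℝ),
      ‖inner ℂ (delta n) (evolution V t (delta 1))‖ ^ 2 * Real.exp (-2 * t / T)
      = 2 / T * ∫ t, ‖dampedAmplitude V (1 / T) (delta 1) n t‖ ^ 2 := fun n => by
    rw [integral_dampedAmplitude_sq]
    congr 3
    funext t
    congr 2
    ring
  have hnonneg : ∀ n : ℕ+, 0 ≤ 2 / T * ∫ t, ‖dampedAmplitude V (1 / T) (delta 1) n t‖ ^ 2 :=
    fun n => mul_nonneg (by positivity) (integral_nonneg fun t => by positivity)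
  have hbound : ∀ s : Finset {n : ℕ+ // x < (n : ℝ)},
      ∑ n ∈ s, 2 / T * ∫ t, ‖dampedAmplitude V (1 / T) (delta 1) n t‖ ^ 2
        ≤ 25 / 4 * (T ^ 4 * (((m + 1 : ℕ) : ℝ) ^ 2 * b ^ 2)) := by
    intro s
    rw [← Finset.mul_sum]
    have h := sum_integral_dampedAmplitude_le V m hb hε hε1 hs'
      (s.map (Function.Embedding.subtype _)) (by
        intro n hn
        obtain ⟨⟨k, hk⟩, -, rfl⟩ := Finset.mem_map.1 hn
        have : ((m + 1 : ℕ) : ℝ) < ((k : ℕ) : ℝ) := hx.trans_lt hk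
        exact_mod_cast this)
    rw [Finset.sum_map] at h
    calc _ ≤ 2 / T * (25 / 8 * ((m + 1) ^ 2 * b ^ 2) / (1 / T) ^ 5) := by
          gcongr
          exact h
      _ = _ := by
          push_cast
          field_simp
          ring
  have hsummable : Summable fun n : {n : ℕ+ // x < (n : ℝ)} =>
      2 / T * ∫ t, ‖dampedAmplitude V (1 / T) (delta 1) n t‖ ^ 2 :=
    summable_of_sum_le (fun n => hnonneg n) hbound
  simp only [tailProb, hterm]
  refine ⟨?_, hsummable.tsum_le_of_sum_le hbound⟩
  obtain ⟨n, hn, hpos⟩ := exists_dampedAmplitude_ne_zero V hε ⌈x⌉₊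
  have hn' : x < (n : ℝ) := (Nat.le_ceil x).trans_lt (by exact_mod_cast hn)
  exact hsummable.tsum_pos (fun n => hnonneg n) ⟨n, hn'⟩ (mul_pos (by positivity) hpos)

end HalfLine

/-! ### From the tail bound to the exponents. -/

namespace HalfLine
open Filter Topology
variable (V : ℓ^∞(ℕ+, ℝ))

lemma bandWidth_le_of_iSup_lt {q : ℕ} {c : ℝ} (h : (⨆ j : Fin q, bandWidth V q j) < c) (j : Fin q) :
    bandWidth V q j ≤ c :=
  (le_ciSup (Set.finite_range _).bddAbove j).trans h.le

/-- Times at which some `q` with thin bands is comparable to `T ^ α'` have a tail rate bounded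
away from zero. -/
lemma eventually_tailRate_le {α α' β C : ℝ} (hβ : 3 < β) (hC : 0 < C) (hα' : 3 / β < α')
    (hα'1 : α' ≤ 1) (hα : α' ≤ α) :
    ∃ δ > 0, ∀ᶠ T : ℝ in atTop, ∀ q : ℕ, 0 < q →
      (∀ j, bandWidth V q j ≤ (q : ℝ) ^ (-β)) → (q : ℝ) ≤ T ^ α' → T ^ α' ≤ C * q →
      tailRate V α T ≤ ((-δ : ℝ) : EReal) := by
  have hβ0 : 0 < β := by linarith
  have h3 : 3 < α' * β := (div_lt_iff₀ hβ0).1 hα'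
  -- Chosen so that `q · q^{-β}` is at most `K T^{-(2 + δ)}`; positivity follows from `α' β > 3` and
  -- `α' ≤ 1`.
  set δ := α' * (β - 1) - 2 with hδ
  have hδ0 : 0 < δ := by
    rw [hδ, mul_sub]
    linarith
  set K := C ^ (β - 1) with hK
  have hK0 : 0 < K := Real.rpow_pos_of_pos hC _
  refine ⟨δ, hδ0, ?_⟩
  have hlim : ∀ A c : ℝ, 0 < c → ∀ᶠ T : ℝ in atTop, A * T ^ (-c) ≤ 1 := fun A c hc => by
    have : Tendsto (fun T : ℝ => A * T ^ (-c)) atTop (𝓝 (A * 0)) :=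
      (tendsto_rpow_neg_atTop hc).const_mul A
    rw [mul_zero] at this
    exact this.eventually_le_const zero_lt_one
  filter_upwards [hlim K (1 + δ) (by linarith), hlim (25 / 4 * K ^ 2) δ hδ0,
    eventually_gt_atTop 1] with T hT1 hT2 hT q hq hb hqT hTq
  have hT0 : 0 < T := by linarith
  have hq0 : (0 : ℝ) < q := by exact_mod_cast hq
  have hqb : (q : ℝ) * (q : ℝ) ^ (-β) ≤ K * T ^ (-(2 + δ)) := by
    have h1 : (q : ℝ) * (q : ℝ) ^ (-β) = (q : ℝ) ^ (-(β - 1)) := by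
      rw [← Real.rpow_one_add' hq0.le (by linarith)]
      congr 1
      ring
    have h2 : K * T ^ (-(2 + δ)) = (T ^ α' / C) ^ (-(β - 1)) := by
      rw [Real.div_rpow (Real.rpow_nonneg hT0.le _) hC.le, ← Real.rpow_mul hT0.le,
        Real.rpow_neg hC.le, div_inv_eq_mul, mul_comm, ← hK]
      congr 2
      rw [hδ]
      ring
    rw [h1, h2]
    refine Real.rpow_le_rpow_of_nonpos (by positivity) ?_ (by linarith)
    rw [div_le_iff₀ hC, mul_comm]
    exact hTq
  have hx : (q : ℝ) ≤ T ^ α := hqT.trans (Real.rpow_le_rpow_of_exponent_le hT.le hα)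
  have hsmall : (q : ℝ) * (q : ℝ) ^ (-β) * T ≤ 1 := by
    calc _ ≤ K * T ^ (-(2 + δ)) * T := by gcongr
      _ = K * T ^ (-(1 + δ)) := by
        rw [mul_assoc, ← Real.rpow_add_one hT0.ne']
        congr 2
        ring
      _ ≤ 1 := hT1
  obtain ⟨hpos, hle⟩ := tailProb_bounds V q hq hb hT.le hsmall hx
  have hP : tailProb V (T ^ α) T ≤ T ^ (-δ) := by
    calc _ ≤ 25 / 4 * (T ^ 4 * (q ^ 2 * ((q : ℝ) ^ (-β)) ^ 2)) := hle
      _ = 25 / 4 * (T ^ 4 * (q * (q : ℝ) ^ (-β)) ^ 2) := by rw [mul_pow]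
      _ ≤ 25 / 4 * (T ^ 4 * (K * T ^ (-(2 + δ))) ^ 2) := by gcongr
      -- The decay is `T^{-2δ}`; one factor `T^{-δ}` is spent on the constant.
      _ = 25 / 4 * K ^ 2 * T ^ (-δ) * T ^ (-δ) := by
        have : T ^ 4 * (T ^ (-(2 + δ))) ^ 2 = T ^ (-δ) * T ^ (-δ) := by
          rw [← Real.rpow_natCast, ← Real.rpow_natCast, ← Real.rpow_mul hT0.le,
            ← Real.rpow_add hT0, ← Real.rpow_add hT0]
          congr 1
          push_cast
          ring
        linear_combination 25 / 4 * K ^ 2 * this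
      _ ≤ 1 * T ^ (-δ) := by gcongr
      _ = T ^ (-δ) := one_mul _
  rw [tailRate, EReal.coe_le_coe_iff, div_le_iff₀ (Real.log_pos hT)]
  calc Real.log (tailProb V (T ^ α) T) ≤ Real.log (T ^ (-δ)) := Real.log_le_log hpos hP
    _ = -δ * Real.log T := Real.log_rpow hT0 _

/-- The sequence need not be monotone: take the step into the first index whose value exceeds `x`.
-/
lemma exists_le_lt_succ_of_tendsto {q : ℕ → ℕ} (hlim : Tendsto q atTop atTop) {x : ℝ}
    (hx : (q 0 : ℝ) ≤ x) : ∃ ℓ, (q ℓ : ℝ) ≤ x ∧ x < q (ℓ + 1) := by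
  classical
  have hex : ∃ m, x < (q m : ℝ) :=
    ((tendsto_natCast_atTop_atTop.comp hlim).eventually_gt_atTop x).exists
  have h0 : Nat.find hex ≠ 0 := fun h => by
    have := Nat.find_spec hex
    rw [h] at this
    linarith
  refine ⟨Nat.find hex - 1, not_lt.1 (Nat.find_min hex (by omega)), ?_⟩
  rw [Nat.sub_add_cancel (by omega)]
  exact Nat.find_spec hex

lemma iSup_ofReal_le_of_forall {S : Set ℝ} {c : ℝ} (h : ∀ α ∈ S, α ≤ c) :
    ⨆ α ∈ S, ENNReal.ofReal α ≤ ENNReal.ofReal c :=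
  iSup₂_le fun α hα => ENNReal.ofReal_le_ofReal (h α hα)

end HalfLine

open Filter in
theorem mainTheorem8 (V : ℓ^∞(ℕ+, ℝ)) (β : ℝ) (hβ : 3 < β)
    (q : ℕ → ℕ) (hq : ∀ ℓ, 1 < q ℓ) (hlim : Filter.Tendsto q Filter.atTop Filter.atTop)
    (hb : ∀ ℓ, (⨆ j : Fin (q ℓ), HalfLine.bandWidth V (q ℓ) j) < (q ℓ : ℝ) ^ (-β)) :
    HalfLine.alphaLowerMinus V ≤ ENNReal.ofReal (3 / β) ∧
    (HalfLine.ExponentiallyGrowing (fun ℓ => (q ℓ : ℝ)) →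
      HalfLine.alphaLowerPlus V ≤ ENNReal.ofReal (3 / β)) := by
  have hβ0 : 0 < β := by linarith
  have h31 : 3 / β < 1 := (div_lt_one hβ0).2 hβ
  have hpos : ∀ ℓ, (0 : ℝ) < q ℓ := fun ℓ => by exact_mod_cast (zero_lt_one.trans (hq ℓ))
  have hqlim : Tendsto (fun ℓ => (q ℓ : ℝ)) atTop atTop := tendsto_natCast_atTop_atTop.comp hlim
  refine ⟨HalfLine.iSup_ofReal_le_of_forall ?_, fun ⟨⟨C, hC⟩, _⟩ =>
    HalfLine.iSup_ofReal_le_of_forall ?_⟩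
  · rintro α ⟨hα0, hα⟩
    by_contra! hlt
    -- The exponent is capped at 1, as the rate estimate requires; since `T^{min α 1} ≤ T^α` for `T
    -- ≥ 1`, the bound still covers the tail beyond `T^α`.
    have hmin : 3 / β < min α 1 := lt_min hlt h31
    have hmin0 : 0 < min α 1 := lt_min hα0 one_pos
    obtain ⟨δ, hδ, hev⟩ := HalfLine.eventually_tailRate_le V hβ one_pos hmin
      (min_le_right α 1) (min_le_left α 1)
    -- At these times `T^{min α 1} = q ℓ` exactly, so the comparison constant is 1.
    have hT : Tendsto (fun ℓ => (q ℓ : ℝ) ^ (min α 1)⁻¹) atTop atTop :=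
      (tendsto_rpow_atTop (inv_pos.2 hmin0)).comp hqlim
    have hfreq : ∃ᶠ T in atTop, HalfLine.tailRate V α T ≤ ((-δ : ℝ) : EReal) := by
      refine hT.frequently (Eventually.frequently ?_)
      filter_upwards [hT.eventually hev] with ℓ hℓ
      have hinv : ((q ℓ : ℝ) ^ (min α 1)⁻¹) ^ (min α 1) = q ℓ :=
        Real.rpow_inv_rpow (hpos ℓ).le hmin0.ne'
      exact hℓ (q ℓ) (zero_lt_one.trans (hq ℓ)) (HalfLine.bandWidth_le_of_iSup_lt V (hb ℓ))
        hinv.ge (by rw [hinv, one_mul])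
    have hle := liminf_le_of_frequently_le' hfreq
    rw [hα] at hle
    have : (0 : ℝ) ≤ -δ := by exact_mod_cast hle
    linarith
  · rintro α ⟨hα0, hα⟩
    by_contra! hlt
    have hmin : 3 / β < min α 1 := lt_min hlt h31
    have hmin0 : 0 < min α 1 := lt_min hα0 one_pos
    have hstep : ∀ ℓ, (q (ℓ + 1) : ℝ) ≤ C * q ℓ := fun ℓ =>
      (div_le_iff₀ (hpos ℓ)).1 (hC ⟨ℓ, rfl⟩)
    have hC0 : 0 < C := (div_pos (hpos 1) (hpos 0)).trans_le (hC ⟨0, rfl⟩)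
    obtain ⟨δ, hδ, hev⟩ := HalfLine.eventually_tailRate_le V hβ hC0 hmin
      (min_le_right α 1) (min_le_left α 1)
    have hevent : ∀ᶠ T in atTop, HalfLine.tailRate V α T ≤ ((-δ : ℝ) : EReal) := by
      -- Every large `T^{min α 1}` lies between some `q ℓ` and `q (ℓ + 1) ≤ C * q ℓ`, so the rate is
      -- negative for all large times and not only along a sequence.
      filter_upwards [hev, (tendsto_rpow_atTop hmin0).eventually_ge_atTop (q 0 : ℝ)] with T hT hT0
      obtain ⟨ℓ, h1, h2⟩ := HalfLine.exists_le_lt_succ_of_tendsto hlim hT0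
      exact hT (q ℓ) (zero_lt_one.trans (hq ℓ)) (HalfLine.bandWidth_le_of_iSup_lt V (hb ℓ)) h1
        (h2.le.trans (hstep ℓ))
    have hle := limsup_le_of_le (by isBoundedDefault) hevent
    rw [hα] at hle
    have : (0 : ℝ) ≤ -δ := by exact_mod_cast hle
    linarith
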